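/- Let $K$ be a field, $n\ge 2$, and $S=K[x_1,\dots,x_n]$. For $1\le m<n$ let $J_{n,m}\subset S$ be the $m$-path ideal of the cycle graph of length $n$, that is, the ideal generated by the $n$ monomials $x_ix_{i+1}\cdots x_{i+m-1}$ $(1\le i\le n)$, where indices are taken modulo $n$. For a proper monomial ideal $I\subset S$, $\operatorname{depth}(S/I)$ is the maximal length of an $S/I$-regular sequence contained in $(x_1,\dots,x_n)$. A Stanley decomposition of $S/I$ is a decomposition $\mathcal D:\ S/I=\bigoplus_{i=1}^r u_iK[Z_i]$ as $\mathbb Z^n$-graded $K$-vector spaces, where the $u_i\in S$ are monomials and $Z_i\subset\{x_1,\dots,x_n\}$; put $\operatorname{sdepth}(\mathcal D)=\min_i|Z_i|$, and let $\operatorname{sdepth}(S/I)$ be the maximum of $\operatorname{sdepth}(\mathcal D)$ over all Stanley decompositions $\mathcal D$ of $S/I$. Then: 1. For all $n\ge 2$ and $t\ge n-1$, $\operatorname{sdepth}(S/J_{n,n-1}^t)=\operatorname{depth}(S/J_{n,n-1}^t)=0$. 2. If $n\ge 3$ is odd, then $\operatorname{sdepth}(S/J_{n,n-2}^t)=\operatorname{depth}(S/J_{n,n-2}^t)=0$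 for all $t\ge \frac{n-1}{2}$. 3. If $n\ge 3$ is even, then $\frac n2\ge \operatorname{sdepth}(S/J_{n,n-2}^t)\ge \operatorname{depth}(S/J_{n,n-2}^t)=1$ for all $t\ge n-1$. -/

import Mathlib

noncomputable section

/-- The `m`-path ideal `J_{n,m}` of the cycle graph of length `n` in `S = K[x_1, …, x_n]`, with the
variables indexed by `Fin n`: it is generated by the `n` products of `m` cyclically consecutive
variables. -/
def cyclePathIdeal (K : Type*) [Field K] (n m : ℕ) : Ideal (MvPolynomial (Fin n) K) :=
  Ideal.span (Set.range fun i : Fin n =>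
    ∏ k ∈ Finset.range m,
      (MvPolynomial.X (⟨(i.val + k) % n, Nat.mod_lt _ i.pos⟩ : Fin n) : MvPolynomial (Fin n) K))

/-- The depth of a graded `K[x_1, …, x_n]`-module `M`: the supremum of the lengths of the
`M`-regular sequences of elements of the ideal `(x_1, …, x_n)`. -/
def polyDepth (K : Type*) [Field K] (n : ℕ) (M : Type*) [AddCommGroup M]
    [Module (MvPolynomial (Fin n) K) M] : ℕ∞ :=
  ⨆ rs : {rs : List (MvPolynomial (Fin n) K) //
      (∀ f ∈ rs, f ∈ Ideal.span (Set.range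
        (MvPolynomial.X : Fin n → MvPolynomial (Fin n) K))) ∧
      RingTheory.Sequence.IsRegular M rs}, (rs.val.length : ℕ∞)

/-- The `K`-subspace `x^a K[Z]` of `S = K[x_1, …, x_n]`. -/
def stanleySpace (K : Type*) [Field K] {n : ℕ} (a : Fin n →₀ ℕ) (Z : Finset (Fin n)) :
    Submodule K (MvPolynomial (Fin n) K) :=
  (Subalgebra.toSubmodule (MvPolynomial.supported K (Z : Set (Fin n)))).map
    (LinearMap.mulLeft K (MvPolynomial.monomial a (1 : K)))

/-- A Stanley decomposition `S/I = ⨁ i, x^{a_i} K[Z_i]` of the quotient of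
`S = K[x_1, …, x_n]` by a monomial ideal `I`, with finitely many summands. Each summand
`x^{a_i} K[Z_i]` embeds in `S/I`, and `S/I` is the internal direct sum of the images. -/
structure StanleyDecomposition {K : Type*} [Field K] {n : ℕ}
    (I : Ideal (MvPolynomial (Fin n) K)) where
  /-- The number of summands. -/
  r : ℕ
  /-- The exponents of the monomials. -/
  a : Fin r → Fin n →₀ ℕ
  /-- The sets of variables. -/
  Z : Fin r → Finset (Fin n)
  embeds : ∀ i, Set.InjOn (Ideal.Quotient.mk I)
    (stanleySpace K (a i) (Z i) : Set (MvPolynomial (Fin n) K))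
  isInternal : DirectSum.IsInternal fun i =>
    (stanleySpace K (a i) (Z i)).map (Ideal.Quotient.mkₐ K I).toLinearMap

/-- The Stanley depth of a Stanley decomposition: the least of the numbers `|Z_i|`. -/
def StanleyDecomposition.sdepth {K : Type*} [Field K] {n : ℕ}
    {I : Ideal (MvPolynomial (Fin n) K)} (D : StanleyDecomposition I) : ℕ∞ :=
  ⨅ i, ((D.Z i).card : ℕ∞)

/-- The Stanley depth of `S/I`, for a monomial ideal `I ≠ S`: the greatest Stanley depth of a
Stanley decomposition of `S/I`. -/
def stanleyDepth {K : Type*} [Field K] {n : ℕ} (I : Ideal (MvPolynomial (Fin n) K)) : ℕ∞ :=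
  ⨆ D : StanleyDecomposition I, D.sdepth

end

/-!
All ideals involved are monomial, so they are governed by their exponent sets `U ⊆ ℕⁿ`, up-sets
for which we ask how the complement can be cut into cones `u + ℕ^Z`. If some `c ∉ U` is a socle
exponent, meaning that `c + eᵢ ∈ U` for all `i`, then both depths vanish; if there is none, both
are positive. If `c + e ∉ U` whenever `e` is supported in one of two complementary sets of
variables, while `c + eᵢ + eⱼ ∈ U` for `i`, `j` in different sets, then `c` makes `S / I` look
disconnected, so its depth is at most `1`, and the cone through `c` is confined to one of the sets.

A product of `t` generators of `J_{n,n-2}` is `(x₁⋯xₙ)^t` divided by the edges (with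
multiplicities `y`) of the `n`-cycle, so `x^c ∈ J_{n,n-2}^t` asks for a cover of the vertices with
demands `t - c v` by `t` edges. For even `n` the cycle is bipartite, and by Kőnig and Egerváry such
a cover exists unless an independent set has demand more than `t`; for odd `n` the whole cycle,
where each edge is counted twice, gives an obstruction. The critical exponents are those with
demand `1 + y v + y (v - 1)`, for edge weights `y` of a suitable total.
-/

open MvPolynomial
open scoped Pointwise Finset

section Cone

variable {σ : Type*}

/-- The exponents of the monomials of the Stanley space `x^a K[Z]`. -/
def cone (a : σ →₀ ℕ) (Z : Finset σ) : Set (σ →₀ ℕ) :=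
  {c | a ≤ c ∧ ∀ v ∉ Z, c v = a v}

theorem add_mem_cone {a c e : σ →₀ ℕ} {Z : Finset σ} (hc : c ∈ cone a Z) (he : e.support ⊆ Z) :
    c + e ∈ cone a Z := by
  refine ⟨hc.1.trans le_self_add, fun v hv => ?_⟩
  rw [Finsupp.add_apply, Finsupp.notMem_support_iff.1 fun h => hv (he h), add_zero, hc.2 v hv]

/-- A partition of a set `P` of exponents into the finitely many cones `cone a Z`,
`(a, Z) ∈ S`: the combinatorial form of a Stanley decomposition. -/
structure IsConePartition (S : Finset ((σ →₀ ℕ) × Finset σ)) (P : Set (σ →₀ ℕ)) : Prop where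
  pairwiseDisjoint : (S : Set ((σ →₀ ℕ) × Finset σ)).PairwiseDisjoint fun p => cone p.1 p.2
  iUnion_eq : ⋃ p ∈ S, cone p.1 p.2 = P

theorem IsConePartition.cone_subset {S : Finset ((σ →₀ ℕ) × Finset σ)} {P : Set (σ →₀ ℕ)}
    (h : IsConePartition S P) {p : (σ →₀ ℕ) × Finset σ} (hp : p ∈ S) : cone p.1 p.2 ⊆ P :=
  h.iUnion_eq ▸ Set.subset_biUnion_of_mem (u := fun p => cone p.1 p.2) hp

theorem IsConePartition.biUnion [DecidableEq σ] {ι : Type*} [Fintype ι]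
    {S : ι → Finset ((σ →₀ ℕ) × Finset σ)} {P : ι → Set (σ →₀ ℕ)}
    (hS : ∀ i, IsConePartition (S i) (P i)) (hP : Pairwise (Function.onFun Disjoint P)) :
    IsConePartition (Finset.univ.biUnion S) (⋃ i, P i) where
  pairwiseDisjoint := by
    intro p hp q hq hpq
    simp only [Finset.coe_biUnion, Set.mem_iUnion, Finset.mem_coe, Finset.mem_univ,
      exists_prop, true_and] at hp hq
    obtain ⟨i, hi⟩ := hp
    obtain ⟨j, hj⟩ := hq
    rcases eq_or_ne i j with rfl | hij
    · exact (hS i).pairwiseDisjoint hi hj hpq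
    · exact (hP hij).mono ((hS i).cone_subset hi) ((hS j).cone_subset hj)
  iUnion_eq := by
    simp only [Finset.mem_biUnion, Finset.mem_univ, true_and, Set.iUnion_exists]
    rw [Set.iUnion_comm]
    exact Set.iUnion_congr fun i => (hS i).iUnion_eq

/-- A set of exponents which is determined by the truncations `v ↦ min (c v) N` of its elements. -/
def TruncationInvariant (N : ℕ) (P : Set (σ →₀ ℕ)) : Prop :=
  ∀ ⦃c d : σ →₀ ℕ⦄, (∀ v, min (c v) N = min (d v) N) → c ∈ P → d ∈ P

theorem TruncationInvariant.sdiff {N : ℕ} {P Q : Set (σ →₀ ℕ)} (hP : TruncationInvariant N P)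
    (hQ : TruncationInvariant N Q) : TruncationInvariant N (P \ Q) :=
  fun _ _ hcd hc => ⟨hP hcd hc.1, fun hd => hc.2 (hQ (fun v => (hcd v).symm) hd)⟩

theorem exists_truncationInvariant [Finite σ] {U : Set (σ →₀ ℕ)} (hU : IsUpperSet U) :
    ∃ N, TruncationInvariant N U := by
  have hfin : {c | Minimal (· ∈ U) c}.Finite :=
    WellQuasiOrderedLE.finite_of_isAntichain (setOfPred_minimal_antichain _)
  obtain ⟨b, hb⟩ := hfin.bddAbove
  have := Fintype.ofFinite σ
  refine ⟨∑ v, b v, fun c d hcd hc => ?_⟩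
  obtain ⟨a, hac, ha⟩ := exists_minimal_le_of_wellFoundedLT (· ∈ U) c hc
  refine hU (fun v => ?_) ha.prop
  have hav : a v ≤ ∑ v, b v :=
    (hb ha v).trans (Finset.single_le_sum (fun _ _ => Nat.zero_le _) (Finset.mem_univ v))
  have := hcd v
  have := hac v
  omega

/-- The truncation of `c` at `N`, forgetting the coordinate `r`. -/
def truncateOff [DecidableEq σ] (N : ℕ) (r : σ) (c : σ →₀ ℕ) (v : σ) : ℕ :=
  if v = r then N else min (c v) N

theorem truncateOff_eq_iff [DecidableEq σ] {N : ℕ} {r : σ} {c d : σ →₀ ℕ} :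
    truncateOff N r c = truncateOff N r d ↔ ∀ v ≠ r, min (c v) N = min (d v) N := by
  rw [funext_iff]
  refine forall_congr' fun v => ?_
  by_cases hv : v = r <;> simp [truncateOff, hv]

theorem finite_range_truncateOff [Finite σ] [DecidableEq σ] (N : ℕ) (r : σ) :
    (Set.range (truncateOff N r)).Finite := by
  refine (Set.Finite.pi' fun _ => Set.finite_Iic N).subset ?_
  rintro _ ⟨c, rfl⟩ v
  simp only [truncateOff, Set.mem_Iic]
  split_ifs <;> omega

theorem TruncationInvariant.infClosed_fiber [DecidableEq σ] {N : ℕ} {P : Set (σ →₀ ℕ)}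
    (hP : TruncationInvariant N P) (r : σ) (b : σ → ℕ) :
    InfClosed {d ∈ P | truncateOff N r d = b} := by
  rintro d ⟨hd, rfl⟩ e ⟨he, hed⟩
  rw [truncateOff_eq_iff] at hed
  have hoff : ∀ v ≠ r, min ((d ⊓ e) v) N = min (d v) N := by
    intro v hv
    have := hed v hv
    simp only [Finsupp.inf_apply]
    omega
  refine ⟨?_, truncateOff_eq_iff.2 hoff⟩
  -- at `r` the minimum agrees with one of `d` and `e`, so it has the same truncation as that one
  rcases le_total (d r) (e r) with h | h
  · refine hP (fun v => ?_) hd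
    rcases eq_or_ne v r with rfl | hv
    · rw [Finsupp.inf_apply, inf_eq_left.2 h]
    · exact (hoff v hv).symm
  · refine hP (fun v => ?_) he
    rcases eq_or_ne v r with rfl | hv
    · rw [Finsupp.inf_apply, inf_eq_right.2 h]
    · rw [hoff v hv, hed v hv]

theorem TruncationInvariant.exists_cone_eq_fiber [Finite σ] [DecidableEq σ] {N : ℕ} {r : σ}
    {P : Set (σ →₀ ℕ)} (hP : TruncationInvariant N P)
    (hr : ∀ c ∈ P, ∀ k, c + Finsupp.single r k ∈ P) {c : σ →₀ ℕ} (hc : c ∈ P) :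
    ∃ a Z, r ∈ Z ∧ cone a Z = {d ∈ P | truncateOff N r d = truncateOff N r c} := by
  have := Fintype.ofFinite σ
  obtain ⟨a, -, ha⟩ := exists_minimal_le_of_wellFoundedLT
    (· ∈ {d ∈ P | truncateOff N r d = truncateOff N r c}) c ⟨hc, rfl⟩
  have hleast := (hP.infClosed_fiber r (truncateOff N r c)).codirectedOn.minimal_iff_isLeast.1 ha
  obtain ⟨haP, hac⟩ := hleast.1
  rw [← hac] at hleast ⊢
  refine ⟨a, Finset.univ.filter fun v => v = r ∨ N ≤ a v, by simp,
    Set.ext fun d => ⟨fun hd => ?_, fun hd => ⟨hleast.2 hd, fun v hv => ?_⟩⟩⟩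
  · have hoff : ∀ v ≠ r, min (d v) N = min (a v) N := by
      intro v hv
      have hle := hd.1 v
      have heq := hd.2 v
      simp only [Finset.mem_filter, Finset.mem_univ, true_and, hv, false_or] at heq
      omega
    refine ⟨hP (fun v => ?_) (hr a haP (d r - a r)), truncateOff_eq_iff.2 hoff⟩
    rcases eq_or_ne v r with rfl | hv
    · rw [Finsupp.add_apply, Finsupp.single_eq_same, add_tsub_cancel_of_le (hd.1 v)]
    · rw [Finsupp.add_apply, Finsupp.single_eq_of_ne hv, add_zero, hoff v hv]
  · simp only [Finset.mem_filter, Finset.mem_univ, true_and, not_or] at hv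
    have := truncateOff_eq_iff.1 hd.2 v hv.1
    omega

theorem exists_isConePartition_of_add_single_mem [Finite σ] {N : ℕ} {r : σ}
    {P : Set (σ →₀ ℕ)} (hP : TruncationInvariant N P)
    (hr : ∀ c ∈ P, ∀ k, c + Finsupp.single r k ∈ P) :
    ∃ S, IsConePartition S P ∧ ∀ p ∈ S, r ∈ p.2 := by
  classical
  have hfin : (truncateOff N r '' P).Finite :=
    (finite_range_truncateOff N r).subset (Set.image_subset_range _ _)
  have hfiber : ∀ b ∈ truncateOff N r '' P, ∃ p : (σ →₀ ℕ) × Finset σ,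
      r ∈ p.2 ∧ cone p.1 p.2 = {d ∈ P | truncateOff N r d = b} := by
    rintro _ ⟨c, hc, rfl⟩
    obtain ⟨a, Z, h⟩ := hP.exists_cone_eq_fiber hr hc
    exact ⟨(a, Z), h⟩
  choose! p hp hcone using hfiber
  refine ⟨hfin.toFinset.image p, ⟨?_, Set.ext fun c => ?_⟩, ?_⟩
  · simp only [Set.PairwiseDisjoint, Set.Pairwise, Finset.coe_image, Set.Finite.coe_toFinset,
      Set.forall_mem_image (f := p)]
    intro b hb b' hb' hne
    simp only [Function.onFun]
    rw [hcone b hb, hcone b' hb', Set.disjoint_left]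
    rintro c ⟨-, rfl⟩ ⟨-, rfl⟩
    exact hne rfl
  · simp only [Finset.mem_image, Set.Finite.mem_toFinset, Set.iUnion_exists,
      Set.biUnion_and', Set.iUnion_iUnion_eq_right, Set.mem_iUnion]
    constructor
    · rintro ⟨b, hb, hc⟩
      exact (hcone b hb ▸ hc).1
    · exact fun hc => ⟨_, ⟨c, hc, rfl⟩, hcone _ ⟨c, hc, rfl⟩ ▸ ⟨hc, rfl⟩⟩
  · simp only [Finset.mem_image, Set.Finite.mem_toFinset]
    rintro _ ⟨b, hb, rfl⟩
    exact hp b hb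

/-- A socle exponent of the complement of `U`: when `U` is the set of exponents of the monomials
of a monomial ideal `I`, these are the exponents of the monomials in the socle of `S/I`. -/
def IsSocleExponent (U : Set (σ →₀ ℕ)) (c : σ →₀ ℕ) : Prop :=
  c ∉ U ∧ ∀ i, c + Finsupp.single i 1 ∈ U

theorem exists_isSocleExponent_of_finite {U : Set (σ →₀ ℕ)} {c : σ →₀ ℕ} (hc : c ∉ U)
    (hfin : {d | c ≤ d ∧ d ∉ U}.Finite) : ∃ d, IsSocleExponent U d := by
  obtain ⟨d, hd⟩ := hfin.exists_maximal ⟨c, le_rfl, hc⟩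
  refine ⟨d, hd.prop.2, fun i => ?_⟩
  by_contra h
  have := hd.le_of_ge ⟨hd.prop.1.trans le_self_add, h⟩ le_self_add i
  simp at this

theorem exists_forall_add_single_notMem [Finite σ] {U : Set (σ →₀ ℕ)} (hU : IsUpperSet U)
    (hsocle : ∀ c, ¬ IsSocleExponent U c) {c : σ →₀ ℕ} (hc : c ∉ U) :
    ∃ r, ∀ k, c + Finsupp.single r k ∉ U := by
  classical
  by_contra! h
  choose k hk using h
  have := Fintype.ofFinite σ
  let b : σ →₀ ℕ := c + Finsupp.equivFunOnFinite.symm k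
  suffices hfin : {d | c ≤ d ∧ d ∉ U} ⊆ Set.Icc c b by
    obtain ⟨d, hd⟩ := exists_isSocleExponent_of_finite hc ((Set.finite_Icc c b).subset hfin)
    exact hsocle d hd
  rintro d ⟨hcd, hd⟩
  refine ⟨hcd, fun i => ?_⟩
  by_contra! hlt
  refine hd (hU (fun v => ?_) (hk i))
  rcases eq_or_ne v i with rfl | hv
  · simpa [b] using hlt.le
  · simpa [Finsupp.single_eq_of_ne hv] using hcd v

/-- The exponents at which the ray in direction `r` avoids `U`. -/
def avoidingRay (U : Set (σ →₀ ℕ)) (r : σ) : Set (σ →₀ ℕ) :=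
  {c | ∀ k, c + Finsupp.single r k ∉ U}

theorem TruncationInvariant.avoidingRay {N : ℕ} {U : Set (σ →₀ ℕ)} (hU : TruncationInvariant N U)
    (r : σ) : TruncationInvariant N (avoidingRay U r) := by
  refine fun c d hcd hc k hk => hc k (hU (fun v => ?_) hk)
  have := hcd v
  simp only [Finsupp.add_apply]
  omega

theorem iUnion_avoidingRay [Finite σ] {U : Set (σ →₀ ℕ)} (hU : IsUpperSet U)
    (hsocle : ∀ c, ¬ IsSocleExponent U c) : ⋃ r, avoidingRay U r = Uᶜ := by
  refine Set.Subset.antisymm (Set.iUnion_subset fun r c hc => ?_) fun c hc =>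
    Set.mem_iUnion.2 (exists_forall_add_single_notMem hU hsocle hc)
  simpa using hc 0

theorem TruncationInvariant.disjointed {ι : Type*} [Preorder ι] [LocallyFiniteOrderBot ι] {N : ℕ}
    {P : ι → Set (σ →₀ ℕ)} (hP : ∀ i, TruncationInvariant N (P i)) (i : ι) :
    TruncationInvariant N (disjointed P i) :=
  disjointedRec (fun {_ _} h => h.sdiff (hP _)) (hP i)

theorem add_single_mem_disjointed_avoidingRay [Preorder σ] [LocallyFiniteOrderBot σ]
    {U : Set (σ →₀ ℕ)} (hU : IsUpperSet U) (r : σ) {c : σ →₀ ℕ}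
    (hc : c ∈ disjointed (avoidingRay U) r) (k : ℕ) :
    c + Finsupp.single r k ∈ disjointed (avoidingRay U) r := by
  simp only [disjointed_eq_inter_compl, Set.mem_inter_iff, Set.mem_iInter, Set.mem_compl_iff]
    at hc ⊢
  refine ⟨fun l hl => hc.1 (k + l) ?_, fun i hi h => hc.2 i hi fun l hl => h l ?_⟩
  · rwa [Finsupp.single_add, ← add_assoc]
  · exact hU (add_le_add_left le_self_add _) hl

theorem exists_isConePartition_compl [Finite σ] [LinearOrder σ] [LocallyFiniteOrderBot σ]
    {U : Set (σ →₀ ℕ)} (hU : IsUpperSet U) (hsocle : ∀ c, ¬ IsSocleExponent U c) :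
    ∃ S, IsConePartition S Uᶜ ∧ ∀ p ∈ S, p.2.Nonempty := by
  have := Fintype.ofFinite σ
  obtain ⟨N, hN⟩ := exists_truncationInvariant hU
  choose S hS hmem using fun r => exists_isConePartition_of_add_single_mem
    (TruncationInvariant.disjointed hN.avoidingRay r)
    (fun _ hc k => add_single_mem_disjointed_avoidingRay hU r hc k)
  refine ⟨Finset.univ.biUnion S, ?_, ?_⟩
  · rw [← iUnion_avoidingRay hU hsocle, ← iUnion_disjointed]
    exact IsConePartition.biUnion hS (disjoint_disjointed _)
  · simp only [Finset.mem_biUnion, Finset.mem_univ, true_and]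
    rintro p ⟨r, hp⟩
    exact ⟨r, hmem r p hp⟩

end Cone

section MonomialIdeal

variable {σ R : Type*}

/-- The exponents of the monomials in an ideal. -/
def exponentSet [CommSemiring R] (I : Ideal (MvPolynomial σ R)) : Set (σ →₀ ℕ) :=
  {c | monomial c (1 : R) ∈ I}

/-- A monomial ideal: with every polynomial it contains all monomials of its support. -/
def IsMonomialIdeal [CommSemiring R] (I : Ideal (MvPolynomial σ R)) : Prop :=
  ∀ f ∈ I, (f.support : Set (σ →₀ ℕ)) ⊆ exponentSet I

section CommSemiring

variable [CommSemiring R] {I : Ideal (MvPolynomial σ R)}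

theorem isUpperSet_exponentSet (I : Ideal (MvPolynomial σ R)) : IsUpperSet (exponentSet I) := by
  rintro a c hac ha
  obtain ⟨b, rfl⟩ := exists_add_of_le hac
  have : monomial a (1 : R) * monomial b 1 ∈ I := I.mul_mem_right _ ha
  rwa [monomial_mul, one_mul] at this

theorem monomial_mem_of_mem_exponentSet {c : σ →₀ ℕ} (hc : c ∈ exponentSet I) (r : R) :
    monomial c r ∈ I := by
  have : C r * monomial c 1 ∈ I := I.mul_mem_left _ hc
  rwa [C_mul_monomial, mul_one] at this

theorem IsMonomialIdeal.coeff_eq_zero (hI : IsMonomialIdeal I) {f : MvPolynomial σ R} (hf : f ∈ I)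
    {c : σ →₀ ℕ} (hc : c ∉ exponentSet I) : coeff c f = 0 :=
  notMem_support_iff.1 fun h => hc (hI f hf h)

theorem exists_mem_support_notMem_exponentSet {f : MvPolynomial σ R} (hf : f ∉ I) :
    ∃ c ∈ f.support, c ∉ exponentSet I := by
  by_contra! h
  refine hf ?_
  rw [f.as_sum]
  exact Ideal.sum_mem _ fun c hc => monomial_mem_of_mem_exponentSet (h c hc) _

theorem mem_exponentSet_span_iff [Nontrivial R] {s : Set (σ →₀ ℕ)} {c : σ →₀ ℕ} :
    c ∈ exponentSet (Ideal.span ((fun a => monomial a (1 : R)) '' s)) ↔ ∃ a ∈ s, a ≤ c := by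
  classical
  simp [exponentSet, mem_ideal_span_monomial_image, support_monomial]

theorem isMonomialIdeal_span (s : Set (σ →₀ ℕ)) :
    IsMonomialIdeal (Ideal.span ((fun a => monomial a (1 : R)) '' s)) := by
  rcases subsingleton_or_nontrivial R with _ | _
  · exact fun f _ c hc => absurd (Subsingleton.elim _ _) (mem_support_iff.1 hc)
  · exact fun f hf c hc =>
      mem_exponentSet_span_iff.2 (mem_ideal_span_monomial_image.1 hf c hc)

end CommSemiring

theorem IsMonomialIdeal.coeff_eq_coeff [CommRing R] {I : Ideal (MvPolynomial σ R)}
    (hI : IsMonomialIdeal I) {f g : MvPolynomial σ R}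
    (hfg : Ideal.Quotient.mk I f = Ideal.Quotient.mk I g) {c : σ →₀ ℕ} (hc : c ∉ exponentSet I) :
    coeff c f = coeff c g := by
  have := hI.coeff_eq_zero (Ideal.Quotient.eq.1 hfg) hc
  rwa [coeff_sub, sub_eq_zero] at this

end MonomialIdeal

section StanleyDepth

variable {K : Type*} [Field K] {n : ℕ} {I : Ideal (MvPolynomial (Fin n) K)}

theorem stanleySpace_eq_restrictSupport (a : Fin n →₀ ℕ) (Z : Finset (Fin n)) :
    stanleySpace K a Z = restrictSupport K (cone a Z) := by
  apply le_antisymm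
  · rintro _ ⟨g, hg, rfl⟩
    rw [mem_restrictSupport_iff]
    intro c hc
    have hc' : coeff c (monomial a (1 : K) * g) ≠ 0 := mem_support_iff.1 hc
    rw [coeff_monomial_mul'] at hc'
    split_ifs at hc' with hac
    · refine ⟨hac, fun v hv => le_antisymm ?_ (hac v)⟩
      by_contra! hlt
      refine hv (mem_supported.1 hg ((mem_vars_iff_mem_support v).2 ⟨c - a, ?_, ?_⟩))
      · exact mem_support_iff.2 (right_ne_zero_of_mul hc')
      · exact Finsupp.mem_support_iff.2 (Nat.sub_ne_zero_of_lt hlt)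
    · exact absurd rfl hc'
  · rw [restrictSupport_eq_span, Submodule.span_le]
    rintro _ ⟨c, ⟨hac, hc⟩, rfl⟩
    refine ⟨monomial (c - a) 1, ?_, ?_⟩
    · change monomial (c - a) (1 : K) ∈ supported K (Z : Set (Fin n))
      rw [mem_supported, vars_monomial one_ne_zero]
      intro v hv
      by_contra hvZ
      exact Finsupp.mem_support_iff.1 hv (Nat.sub_eq_zero_of_le (hc v hvZ).le)
    · simp [monomial_mul, add_tsub_cancel_of_le hac]

theorem mem_stanleySpace_iff {a : Fin n →₀ ℕ} {Z : Finset (Fin n)} {f : MvPolynomial (Fin n) K} :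
    f ∈ stanleySpace K a Z ↔ (f.support : Set (Fin n →₀ ℕ)) ⊆ cone a Z := by
  rw [stanleySpace_eq_restrictSupport, mem_restrictSupport_iff]

theorem monomial_mem_stanleySpace {a c : Fin n →₀ ℕ} {Z : Finset (Fin n)} (hc : c ∈ cone a Z)
    (r : K) : monomial c r ∈ stanleySpace K a Z := by
  rw [stanleySpace_eq_restrictSupport, monomial_mem_restrictSupport]
  exact .inl hc

theorem iSup_stanleySpace_le {ι : Sort*} (a : ι → Fin n →₀ ℕ) (Z : ι → Finset (Fin n)) :
    ⨆ i, stanleySpace K (a i) (Z i) ≤ restrictSupport K (⋃ i, cone (a i) (Z i)) := by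
  simp only [stanleySpace_eq_restrictSupport]
  exact iSup_le fun i => restrictSupport_mono _ (Set.subset_iUnion (fun i => cone (a i) (Z i)) i)

theorem StanleyDecomposition.exists_mem_cone (D : StanleyDecomposition I) (hI : IsMonomialIdeal I)
    {c : Fin n →₀ ℕ} (hc : c ∉ exponentSet I) : ∃ i, c ∈ cone (D.a i) (D.Z i) := by
  have hmem : (Ideal.Quotient.mkₐ K I).toLinearMap (monomial c 1) ∈
      ⨆ i, (stanleySpace K (D.a i) (D.Z i)).map (Ideal.Quotient.mkₐ K I).toLinearMap :=
    D.isInternal.submodule_iSup_eq_top ▸ Submodule.mem_top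
  rw [← Submodule.map_iSup] at hmem
  obtain ⟨f, hf, hfc⟩ := hmem
  have hcoeff : coeff c f = 1 := by
    rw [hI.coeff_eq_coeff hfc hc, coeff_monomial, if_pos rfl]
  have hsupp : c ∈ f.support := mem_support_iff.2 (hcoeff ▸ one_ne_zero)
  exact Set.mem_iUnion.1 ((mem_restrictSupport_iff K).1 (iSup_stanleySpace_le _ _ hf) hsupp)

theorem StanleyDecomposition.cone_subset_compl (D : StanleyDecomposition I) (i : Fin D.r) :
    cone (D.a i) (D.Z i) ⊆ (exponentSet I)ᶜ := by
  intro c hc hcI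
  have := D.embeds i (monomial_mem_stanleySpace hc 1) (Submodule.zero_mem _)
    (by rw [map_zero]; exact Ideal.Quotient.eq_zero_iff_mem.2 hcI)
  exact one_ne_zero (monomial_eq_zero.1 this)

theorem stanleyDepth_le (hI : IsMonomialIdeal I) {c : Fin n →₀ ℕ} {k : ℕ}
    (hc : c ∉ exponentSet I)
    (hk : ∀ Z : Finset (Fin n),
      (∀ e : Fin n →₀ ℕ, e.support ⊆ Z → c + e ∉ exponentSet I) → Z.card ≤ k) :
    stanleyDepth I ≤ k := by
  refine iSup_le fun D => ?_
  obtain ⟨i, hi⟩ := D.exists_mem_cone hI hc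
  refine (iInf_le _ i).trans (Nat.cast_le.2 (hk _ fun e he => ?_))
  exact D.cone_subset_compl i (add_mem_cone hi he)

theorem stanleyDepth_eq_zero (hI : IsMonomialIdeal I) {c : Fin n →₀ ℕ}
    (hc : IsSocleExponent (exponentSet I) c) : stanleyDepth I = 0 := by
  refine nonpos_iff_eq_zero.1 (stanleyDepth_le (k := 0) hI hc.1 fun Z hZ => ?_)
  rw [Nat.le_zero, Finset.card_eq_zero, Finset.eq_empty_iff_forall_notMem]
  intro i hi
  refine hZ _ (Finsupp.support_single_subset.trans ?_) (hc.2 i)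
  rwa [Finset.singleton_subset_iff]

theorem disjoint_map_mk_restrictSupport {σ : Type*} {I : Ideal (MvPolynomial σ K)}
    (hI : IsMonomialIdeal I) {A B : Set (σ →₀ ℕ)} (hA : A ⊆ (exponentSet I)ᶜ)
    (hAB : Disjoint A B) :
    Disjoint ((restrictSupport K A).map (Ideal.Quotient.mkₐ K I).toLinearMap)
      ((restrictSupport K B).map (Ideal.Quotient.mkₐ K I).toLinearMap) := by
  rw [Submodule.disjoint_def]
  rintro _ ⟨f, hf, rfl⟩ ⟨g, hg, hgf⟩
  suffices f = 0 by rw [this, map_zero]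
  rw [← support_eq_empty, Finset.eq_empty_iff_forall_notMem]
  intro c hc
  have hcA : c ∈ A := (mem_restrictSupport_iff K).1 hf hc
  have hcg : c ∈ g.support := by
    rwa [mem_support_iff, hI.coeff_eq_coeff hgf (hA hcA), ← mem_support_iff]
  exact hAB.notMem_of_mem_left hcA ((mem_restrictSupport_iff K).1 hg hcg)

variable {S : Finset ((Fin n →₀ ℕ) × Finset (Fin n))}

theorem injOn_mk_stanleySpace (hI : IsMonomialIdeal I)
    {p : (Fin n →₀ ℕ) × Finset (Fin n)} (hp : cone p.1 p.2 ⊆ (exponentSet I)ᶜ) :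
    Set.InjOn (Ideal.Quotient.mk I)
      (stanleySpace K p.1 p.2 : Set (MvPolynomial (Fin n) K)) := by
  intro f hf g hg hfg
  rw [← sub_eq_zero, ← support_eq_empty, Finset.eq_empty_iff_forall_notMem]
  intro c hc
  have hcone := mem_stanleySpace_iff.1 (Submodule.sub_mem _ hf hg) hc
  exact hp hcone (hI _ (Ideal.Quotient.eq.1 hfg) hc)

theorem map_mk_iSup_stanleySpace_eq_top {ι : Type*} {a : ι → Fin n →₀ ℕ}
    {Z : ι → Finset (Fin n)} (h : (exponentSet I)ᶜ ⊆ ⋃ i, cone (a i) (Z i)) :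
    ⨆ i, (stanleySpace K (a i) (Z i)).map (Ideal.Quotient.mkₐ K I).toLinearMap = ⊤ := by
  rw [← Submodule.map_iSup, eq_top_iff]
  rintro x -
  obtain ⟨f, rfl⟩ := Ideal.Quotient.mk_surjective x
  induction f using MvPolynomial.induction_on' with
  | monomial c r =>
    by_cases hc : c ∈ exponentSet I
    · rw [Ideal.Quotient.eq_zero_iff_mem.2 (monomial_mem_of_mem_exponentSet hc r)]
      exact Submodule.zero_mem _
    · obtain ⟨i, hi⟩ := Set.mem_iUnion.1 (h hc)
      exact ⟨_, Submodule.mem_iSup_of_mem i (monomial_mem_stanleySpace hi r), rfl⟩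
  | add p q hp hq => rw [map_add]; exact Submodule.add_mem _ hp hq

theorem iSupIndep_map_mk_stanleySpace (hI : IsMonomialIdeal I) {ι : Type*} {a : ι → Fin n →₀ ℕ}
    {Z : ι → Finset (Fin n)} (hsub : ∀ i, cone (a i) (Z i) ⊆ (exponentSet I)ᶜ)
    (hdisj : Pairwise (Function.onFun Disjoint fun i => cone (a i) (Z i))) :
    iSupIndep fun i =>
      (stanleySpace K (a i) (Z i)).map (Ideal.Quotient.mkₐ K I).toLinearMap := by
  intro i
  simp only [← Submodule.map_iSup]
  rw [stanleySpace_eq_restrictSupport]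
  refine (disjoint_map_mk_restrictSupport hI (hsub i) (B := ⋃ (j) (_ : j ≠ i), cone (a j) (Z j))
    ?_).mono_right (Submodule.map_mono ?_)
  · simp only [Set.disjoint_iUnion_right]
    exact fun j hj => hdisj hj.symm
  · refine iSup₂_le fun j hj => ?_
    rw [stanleySpace_eq_restrictSupport]
    exact restrictSupport_mono _ (Set.subset_biUnion_of_mem (u := fun j => cone (a j) (Z j)) hj)

/-- The Stanley decomposition of `S/I` given by a partition into cones of the set of exponents
outside `I`. -/
noncomputable def IsConePartition.stanleyDecomposition (hS : IsConePartition S (exponentSet I)ᶜ)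
    (hI : IsMonomialIdeal I) : StanleyDecomposition I where
  r := S.card
  a i := (S.equivFin.symm i).1.1
  Z i := (S.equivFin.symm i).1.2
  embeds i := injOn_mk_stanleySpace hI (hS.cone_subset (S.equivFin.symm i).2)
  isInternal := by
    rw [DirectSum.isInternal_submodule_iff_iSupIndep_and_iSup_eq_top]
    refine ⟨iSupIndep_map_mk_stanleySpace hI (fun i => hS.cone_subset (S.equivFin.symm i).2)
      fun i j hij => hS.pairwiseDisjoint (S.equivFin.symm i).2 (S.equivFin.symm j).2
        fun h => hij (S.equivFin.symm.injective (Subtype.ext h)),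
      map_mk_iSup_stanleySpace_eq_top ?_⟩
    rw [← hS.iUnion_eq]
    refine Set.iUnion₂_subset fun p hp => ?_
    refine Set.subset_iUnion_of_subset (S.equivFin ⟨p, hp⟩) ?_
    rw [Equiv.symm_apply_apply]

theorem one_le_stanleyDepth (hI : IsMonomialIdeal I)
    (hsocle : ∀ c, ¬ IsSocleExponent (exponentSet I) c) : 1 ≤ stanleyDepth I := by
  obtain ⟨S, hS, hne⟩ := exists_isConePartition_compl (isUpperSet_exponentSet I) hsocle
  refine le_iSup_of_le (hS.stanleyDecomposition hI) (le_iInf fun i => ?_)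
  exact Nat.one_le_cast.2 (Finset.one_le_card.2 (hne _ (S.equivFin.symm i).2))

end StanleyDepth

section Depth

/-- The `H⁰`–`H¹` argument for depth at least two: `a ⊔ b` cannot disconnect a module on which it
has a regular pair. -/
theorem exists_add_eq_of_isSMulRegular_pair {R M : Type*} [CommRing R] [AddCommGroup M]
    [Module R M] {a b : Ideal R} {f g : R} (hf : f ∈ a ⊔ b) (hg : g ∈ a ⊔ b)
    (hfreg : IsSMulRegular M f) (hgreg : IsSMulRegular (QuotSMulTop f M) g) {u : M}
    (hu : ∀ r ∈ a, ∀ s ∈ b, r • s • u = 0) :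
    ∃ x y : M, x + y = u ∧ (∀ s ∈ b, s • x = 0) ∧ ∀ r ∈ a, r • y = 0 := by
  obtain ⟨fa, hfa, fb, hfb, rfl⟩ := Submodule.mem_sup.1 hf
  obtain ⟨ga, hga, gb, hgb, rfl⟩ := Submodule.mem_sup.1 hg
  have hdiv : fa • u ∈ ((fa + fb) • ⊤ : Submodule R M) := by
    have hswap : (ga + gb) • fa • u = (fa + fb) • ga • u := by
      rw [add_smul, add_smul, smul_comm gb, hu fa hfa gb hgb, smul_comm fb, hu ga hga fb hfb,
        smul_comm]
    rw [← Submodule.Quotient.mk_eq_zero]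
    refine hgreg.right_eq_zero_of_smul ?_
    rw [← Submodule.Quotient.mk_smul, Submodule.Quotient.mk_eq_zero, hswap]
    exact Submodule.smul_mem_pointwise_smul _ _ _ trivial
  obtain ⟨x, -, hx⟩ := (Submodule.mem_smul_pointwise_iff_exists _ _ _).1 hdiv
  refine ⟨x, u - x, add_sub_cancel _ _, fun s hs => hfreg.right_eq_zero_of_smul ?_,
    fun r hr => hfreg.right_eq_zero_of_smul ?_⟩
  · rw [smul_comm, hx, smul_comm, hu fa hfa s hs]
  · rw [smul_comm, smul_sub, hx, add_smul, add_sub_cancel_left, hu r hr fb hfb]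

variable {K : Type*} [Field K] {n : ℕ} {I : Ideal (MvPolynomial (Fin n) K)}

theorem X_mul_monomial_mem_iff {σ R : Type*} [CommSemiring R] {I : Ideal (MvPolynomial σ R)}
    {i : σ} {c : σ →₀ ℕ} :
    X i * monomial c (1 : R) ∈ I ↔ c + Finsupp.single i 1 ∈ exponentSet I := by
  rw [X, monomial_mul, one_mul, add_comm]
  rfl

theorem smul_eq_zero_of_mem_span_X {σ R M : Type*} [CommSemiring R] [AddCommMonoid M]
    [Module (MvPolynomial σ R) M] {A : Set σ} {u : M}
    (hu : ∀ i ∈ A, (X i : MvPolynomial σ R) • u = 0)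
    {f : MvPolynomial σ R} (hf : f ∈ Ideal.span (X '' A)) : f • u = 0 := by
  have : Ideal.span (X '' A) ≤ LinearMap.ker (LinearMap.toSpanSingleton (MvPolynomial σ R) M u) :=
    Ideal.span_le.2 (Set.image_subset_iff.2 hu)
  exact this hf

theorem IsMonomialIdeal.coeff_eq_zero_of_X_mul_mem {σ R : Type*} [CommSemiring R]
    {I : Ideal (MvPolynomial σ R)} (hI : IsMonomialIdeal I) {i : σ} {c : σ →₀ ℕ}
    (hc : c + Finsupp.single i 1 ∉ exponentSet I) {f : MvPolynomial σ R} (hf : X i * f ∈ I) :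
    coeff c f = 0 := by
  rw [← coeff_mul_X c i, mul_comm]
  exact hI.coeff_eq_zero hf hc

theorem span_range_X_eq_sup {σ R : Type*} [CommSemiring R] (A : Set σ) :
    Ideal.span (Set.range (X : σ → MvPolynomial σ R)) =
      Ideal.span (X '' A) ⊔ Ideal.span (X '' Aᶜ) := by
  rw [← Ideal.span_union, ← Set.image_union, Set.union_compl_self, Set.image_univ]

theorem smul_smul_mk_monomial_eq_zero {σ R : Type*} [CommRing R] {I : Ideal (MvPolynomial σ R)}
    {c : σ →₀ ℕ} {A B : Set σ}
    (h : ∀ i ∈ A, ∀ j ∈ B, c + Finsupp.single i 1 + Finsupp.single j 1 ∈ exponentSet I) :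
    ∀ r ∈ Ideal.span ((X : σ → MvPolynomial σ R) '' A),
      ∀ s ∈ Ideal.span ((X : σ → MvPolynomial σ R) '' B),
      r • s • Ideal.Quotient.mk I (monomial c (1 : R)) = 0 := by
  intro r hr s hs
  rw [smul_comm]
  refine smul_eq_zero_of_mem_span_X (fun j hj => ?_) hs
  rw [smul_comm]
  refine smul_eq_zero_of_mem_span_X (fun i hi => Ideal.Quotient.eq_zero_iff_mem.2 ?_) hr
  change X i * (X j * monomial c 1) ∈ I
  rw [mul_left_comm, X, X, monomial_mul, monomial_mul, one_mul, one_mul,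
    add_comm, add_comm (Finsupp.single i 1)]
  exact h i hi j hj

theorem polyDepth_eq_zero {c : Fin n →₀ ℕ} (hc : IsSocleExponent (exponentSet I) c) :
    polyDepth K n (MvPolynomial (Fin n) K ⧸ I) = 0 := by
  refine nonpos_iff_eq_zero.1 (iSup_le ?_)
  rintro ⟨rs, hrs, hreg⟩
  match rs with
  | [] => simp
  | f :: rs =>
    have hfreg := ((RingTheory.Sequence.isRegular_cons_iff _ _ _).1 hreg).1
    have hfX : f ∈ Ideal.span (X '' Set.univ) := by
      simpa only [Set.image_univ] using hrs f (List.mem_cons_self ..)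
    have hfc : f • Ideal.Quotient.mk I (monomial c 1) = 0 :=
      smul_eq_zero_of_mem_span_X (fun i _ =>
        Ideal.Quotient.eq_zero_iff_mem.2 (X_mul_monomial_mem_iff.2 (hc.2 i))) hfX
    exact absurd (Ideal.Quotient.eq_zero_iff_mem.1 (hfreg.right_eq_zero_of_smul hfc)) hc.1

/-- A monomial witness for depth at most one: outside `I`, the monomial `x^c` has a disconnected
set of directions. -/
theorem polyDepth_le_one (hI : IsMonomialIdeal I) {c : Fin n →₀ ℕ} (A : Set (Fin n))
    {i₀ j₀ : Fin n} (hi₀ : i₀ ∈ A) (hj₀ : j₀ ∉ A)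
    (hi : c + Finsupp.single i₀ 1 ∉ exponentSet I)
    (hj : c + Finsupp.single j₀ 1 ∉ exponentSet I)
    (h : ∀ i ∈ A, ∀ j ∉ A, c + Finsupp.single i 1 + Finsupp.single j 1 ∈ exponentSet I) :
    polyDepth K n (MvPolynomial (Fin n) K ⧸ I) ≤ 1 := by
  refine iSup_le ?_
  rintro ⟨rs, hrs, hreg⟩
  match rs with
  | [] => simp
  | [f] => simp
  | f :: g :: rs =>
    exfalso
    rw [RingTheory.Sequence.isRegular_cons_iff, RingTheory.Sequence.isRegular_cons_iff] at hreg
    rw [span_range_X_eq_sup A] at hrs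
    obtain ⟨x, y, hxy, hx, hy⟩ := exists_add_eq_of_isSMulRegular_pair (hrs f (by simp))
      (hrs g (by simp)) hreg.1 hreg.2.1 (smul_smul_mk_monomial_eq_zero h)
    obtain ⟨p, rfl⟩ := Ideal.Quotient.mk_surjective x
    obtain ⟨q, rfl⟩ := Ideal.Quotient.mk_surjective y
    have hp := hI.coeff_eq_zero_of_X_mul_mem hj
      (Ideal.Quotient.eq_zero_iff_mem.1 (hx _ (Ideal.subset_span ⟨j₀, hj₀, rfl⟩)))
    have hq := hI.coeff_eq_zero_of_X_mul_mem hi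
      (Ideal.Quotient.eq_zero_iff_mem.1 (hy _ (Ideal.subset_span ⟨i₀, hi₀, rfl⟩)))
    have hc : c ∉ exponentSet I := fun hc => hi (isUpperSet_exponentSet I le_self_add hc)
    have hsum := hI.coeff_eq_coeff ((map_add (Ideal.Quotient.mk I) p q).trans hxy) hc
    rw [coeff_add, hp, hq, coeff_monomial, if_pos rfl, add_zero] at hsum
    exact zero_ne_one hsum

theorem IsMonomialIdeal.le_idealOfVars {σ R : Type*} [CommSemiring R]
    {I : Ideal (MvPolynomial σ R)} (hI : IsMonomialIdeal I) (htop : I ≠ ⊤) :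
    I ≤ idealOfVars σ R := by
  intro f hf
  rw [← pow_one (idealOfVars σ R), mem_pow_idealOfVars_iff]
  intro c hc
  rw [Nat.one_le_iff_ne_zero, Ne, Finsupp.degree_eq_zero_iff]
  rintro rfl
  exact htop ((Ideal.eq_top_iff_one _).2 (hI f hf hc))

theorem exists_isSMulRegular_mem_idealOfVars {σ : Type*} [Finite σ]
    {I : Ideal (MvPolynomial σ K)} (hI : IsMonomialIdeal I)
    (hsocle : ∀ c, ¬ IsSocleExponent (exponentSet I) c) :
    ∃ f ∈ idealOfVars σ K, IsSMulRegular (MvPolynomial σ K ⧸ I) f := by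
  rw [← Ideal.annihilator_quotient (I := idealOfVars σ K),
    ← IsSMulRegular.subsingleton_linearMap_iff]
  refine subsingleton_of_forall_eq 0 fun φ => ?_
  obtain ⟨g, hg⟩ := Ideal.Quotient.mk_surjective (φ 1)
  have hX : ∀ i, X i * g ∈ I := by
    intro i
    have hXi : Ideal.Quotient.mk (idealOfVars σ K) (X i) = 0 :=
      Ideal.Quotient.eq_zero_iff_mem.2 (Ideal.subset_span ⟨i, rfl⟩)
    rw [← Ideal.Quotient.eq_zero_iff_mem, map_mul, hg, ← map_zero φ, ← hXi,
      ← mul_one (Ideal.Quotient.mk (idealOfVars σ K) (X i))]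
    exact (φ.map_smul (X i) 1).symm
  have hgI : g ∈ I := by
    by_contra hgI
    obtain ⟨c, hc, hcI⟩ := exists_mem_support_notMem_exponentSet hgI
    refine hsocle c ⟨hcI, fun i => ?_⟩
    by_contra hi
    exact mem_support_iff.1 hc (hI.coeff_eq_zero_of_X_mul_mem hi (hX i))
  refine LinearMap.ext fun x => ?_
  obtain ⟨p, rfl⟩ := Ideal.Quotient.mk_surjective x
  have hp : φ (Ideal.Quotient.mk _ p) = p • φ 1 := by
    rw [← mul_one (Ideal.Quotient.mk _ p)]
    exact φ.map_smul p 1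
  rw [hp, ← hg, Ideal.Quotient.eq_zero_iff_mem.2 hgI, smul_zero, LinearMap.zero_apply]

theorem one_notMem_idealOfVars {σ R : Type*} [CommSemiring R] [Nontrivial R] :
    (1 : MvPolynomial σ R) ∉ idealOfVars σ R := by
  rw [← pow_one (idealOfVars σ R), mem_pow_idealOfVars_iff]
  intro h
  exact absurd (h 0 (by simp)) (by simp)

theorem one_le_polyDepth (hI : IsMonomialIdeal I) (htop : I ≠ ⊤)
    (hsocle : ∀ c, ¬ IsSocleExponent (exponentSet I) c) :
    1 ≤ polyDepth K n (MvPolynomial (Fin n) K ⧸ I) := by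
  obtain ⟨f, hf, hfreg⟩ := exists_isSMulRegular_mem_idealOfVars hI hsocle
  have hreg : RingTheory.Sequence.IsRegular (MvPolynomial (Fin n) K ⧸ I) [f] := by
    refine ⟨(RingTheory.Sequence.isWeaklyRegular_singleton_iff _ _).2 hfreg, fun h => ?_⟩
    rw [Ideal.ofList_singleton, Submodule.ideal_span_singleton_smul] at h
    obtain ⟨x, -, hx⟩ := (Submodule.mem_smul_pointwise_iff_exists _ _ _).1
      (h ▸ Submodule.mem_top (x := Ideal.Quotient.mk I 1))
    obtain ⟨p, rfl⟩ := Ideal.Quotient.mk_surjective x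
    have hfp : f * p - 1 ∈ I := Ideal.Quotient.eq.1 hx
    have := sub_mem (Ideal.mul_mem_right p _ hf) (hI.le_idealOfVars htop hfp)
    rw [sub_sub_cancel] at this
    exact one_notMem_idealOfVars this
  exact le_iSup_of_le ⟨[f], by simpa using hf, hreg⟩ (by simp)

end Depth

section MonomialPower

theorem mem_nsmul_range_iff {ι M : Type*} [Fintype ι] [AddCommMonoid M] {g : ι → M} {t : ℕ}
    {a : M} : a ∈ t • Set.range g ↔ ∃ y : ι → ℕ, ∑ i, y i = t ∧ ∑ i, y i • g i = a := by
  classical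
  constructor
  · induction t generalizing a with
    | zero =>
      rintro rfl
      exact ⟨0, by simp, by simp⟩
    | succ t ih =>
      rw [succ_nsmul, Set.mem_add]
      rintro ⟨b, hb, _, ⟨i, rfl⟩, rfl⟩
      obtain ⟨y, hy, rfl⟩ := ih hb
      refine ⟨y + Pi.single i 1, ?_, ?_⟩
      · simp [Finset.sum_add_distrib, hy]
      · simp [add_smul, Finset.sum_add_distrib, Pi.single_apply, ite_smul]
  · rintro ⟨y, rfl, rfl⟩
    rw [← Finset.sum_nsmul_assoc]
    exact Set.finsetSum_mem_finsetSum _ _ _ fun i _ => Set.nsmul_mem_nsmul (Set.mem_range_self i)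

theorem span_monomial_pow {σ R : Type*} [CommSemiring R] (s : Set (σ →₀ ℕ)) (t : ℕ) :
    Ideal.span ((fun a => monomial a (1 : R)) '' s) ^ t =
      Ideal.span ((fun a => monomial a (1 : R)) '' (t • s)) := by
  induction t with
  | zero => simp [Ideal.one_eq_top, Ideal.span_singleton_one, ← Set.singleton_zero]
  | succ t ih =>
    rw [pow_succ, ih, Ideal.span_mul_span', succ_nsmul, ← Set.image2_mul, ← Set.image2_add,
      Set.image2_image_left, Set.image2_image_right, Set.image_image2]
    simp only [monomial_mul, mul_one]

variable {σ ι R : Type*} [Fintype σ] [DecidableEq σ] [CommSemiring R]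

theorem range_prod_compl_X_eq (B : ι → Finset σ) :
    (Set.range fun i => ∏ v ∈ (B i)ᶜ, (X v : MvPolynomial σ R)) =
      (fun a => monomial a (1 : R)) ''
        Set.range fun i => ∑ v ∈ (B i)ᶜ, Finsupp.single v 1 := by
  rw [← Set.range_comp]
  congr! 2 with i
  exact (monomial_sum_one _ _).symm

theorem isMonomialIdeal_span_prod_compl_X_pow (B : ι → Finset σ) (t : ℕ) :
    IsMonomialIdeal
      (Ideal.span (Set.range fun i => ∏ v ∈ (B i)ᶜ, (X v : MvPolynomial σ R)) ^ t) := by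
  rw [range_prod_compl_X_eq, span_monomial_pow]
  exact isMonomialIdeal_span _

/-- A product of `t` of the generators has degree at most `c v` in `x_v` if and only if at least
`t - c v` of the factors omit `x_v`. -/
theorem mem_exponentSet_span_prod_compl_X_pow_iff [Fintype ι] [Nontrivial R] {B : ι → Finset σ}
    {t : ℕ} {c : σ →₀ ℕ} :
    c ∈ exponentSet
        (Ideal.span (Set.range fun i => ∏ v ∈ (B i)ᶜ, (X v : MvPolynomial σ R)) ^ t) ↔
      ∃ y : ι → ℕ, ∑ i, y i = t ∧ ∀ v, t ≤ c v + ∑ i with v ∈ B i, y i := by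
  rw [range_prod_compl_X_eq, span_monomial_pow, mem_exponentSet_span_iff]
  have hdeg : ∀ (y : ι → ℕ) v, (∑ i, y i • ∑ u ∈ (B i)ᶜ, Finsupp.single u 1) v +
      ∑ i with v ∈ B i, y i = ∑ i, y i := by
    intro y v
    rw [Finsupp.finsetSum_apply, Finset.sum_filter, ← Finset.sum_add_distrib]
    refine Finset.sum_congr rfl fun i _ => ?_
    by_cases hv : v ∈ B i <;> simp [Finsupp.single_apply, hv]
  simp only [mem_nsmul_range_iff]
  constructor
  · rintro ⟨_, ⟨y, rfl, rfl⟩, hle⟩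
    exact ⟨y, rfl, fun v => (hdeg y v).ge.trans (Nat.add_le_add_right (hle v) _)⟩
  · rintro ⟨y, rfl, hle⟩
    exact ⟨_, ⟨y, rfl, rfl⟩, fun v => Nat.le_of_add_le_add_right ((hdeg y v).le.trans (hle v))⟩

end MonomialPower

section CyclePathIdeal

variable {n : ℕ}

/-- The `m` cyclically consecutive elements `i, i + 1, …, i + m - 1` of `Fin n`, for `m ≤ n`. -/
def cyclicArc (i : Fin n) (m : ℕ) : Finset (Fin n) :=
  {v | (v - i).val < m}

theorem mem_cyclicArc {i v : Fin n} {m : ℕ} : v ∈ cyclicArc i m ↔ (v - i).val < m := by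
  simp [cyclicArc]

theorem prod_range_eq_prod_cyclicArc {M : Type*} [CommMonoid M] {m : ℕ} (hm : m ≤ n) (i : Fin n)
    (f : Fin n → M) :
    ∏ k ∈ Finset.range m, f ⟨(i.val + k) % n, Nat.mod_lt _ i.pos⟩ =
      ∏ v ∈ cyclicArc i m, f v := by
  have : NeZero n := ⟨i.pos.ne'⟩
  have hadd : ∀ k, (⟨(i.val + k) % n, Nat.mod_lt _ i.pos⟩ : Fin n) = Fin.ofNat n k + i :=
    fun k => Fin.ext (by simp [Fin.val_add, Fin.ofNat, add_comm])
  have hval : ∀ k < m, (Fin.ofNat n k).val = k := fun k hk => Nat.mod_eq_of_lt (hk.trans_le hm)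
  refine Finset.prod_nbij' (fun k => Fin.ofNat n k + i) (fun v => (v - i).val) ?_ ?_ ?_ ?_ ?_
  · intro k hk
    rw [Finset.mem_range] at hk
    rwa [mem_cyclicArc, add_sub_cancel_right, hval k hk]
  · exact fun v hv => Finset.mem_range.2 (mem_cyclicArc.1 hv)
  · intro k hk
    rw [add_sub_cancel_right, hval k (Finset.mem_range.1 hk)]
  · exact fun v _ => by simp
  · exact fun k _ => congrArg f (hadd k)

theorem compl_cyclicArc [NeZero n] {m : ℕ} (hm : m ≤ n) (i : Fin n) :
    (cyclicArc i (n - m))ᶜ = cyclicArc (i - Fin.ofNat n m) m := by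
  ext v
  obtain ⟨u, rfl⟩ : ∃ u, v = u + i := ⟨v - i, by simp⟩
  rw [Finset.mem_compl, mem_cyclicArc, mem_cyclicArc, add_sub_cancel_right]
  have : u + i - (i - Fin.ofNat n m) = u + Fin.ofNat n m := by abel
  rw [this, Fin.val_add, Fin.val_ofNat, Nat.add_mod_mod]
  rcases lt_or_ge (u.val + m) n with h | h
  · rw [Nat.mod_eq_of_lt h]
    omega
  · rw [Nat.mod_eq_sub_mod h, Nat.mod_eq_of_lt (by omega)]
    omega

variable {K : Type*} [Field K]

theorem cyclePathIdeal_eq_span_prod_compl {m : ℕ} (hm : m ≤ n) :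
    cyclePathIdeal K n m =
      Ideal.span (Set.range fun i : Fin n => ∏ v ∈ (cyclicArc i (n - m))ᶜ, X v) := by
  rcases n.eq_zero_or_pos with rfl | hn
  · rw [cyclePathIdeal, Set.range_eq_empty, Set.range_eq_empty]
  · have : NeZero n := ⟨hn.ne'⟩
    simp only [cyclePathIdeal, prod_range_eq_prod_cyclicArc hm, compl_cyclicArc hm]
    congr 1
    exact ((Equiv.subRight (Fin.ofNat n m)).surjective.range_comp
      fun i => ∏ v ∈ cyclicArc i m, (X v : MvPolynomial (Fin n) K)).symm

theorem isMonomialIdeal_cyclePathIdeal_pow {m : ℕ} (hm : m ≤ n) (t : ℕ) :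
    IsMonomialIdeal (cyclePathIdeal K n m ^ t) := by
  rw [cyclePathIdeal_eq_span_prod_compl hm]
  exact isMonomialIdeal_span_prod_compl_X_pow _ t

theorem mem_exponentSet_cyclePathIdeal_pow_iff {m : ℕ} (hm : m ≤ n) {t : ℕ} {c : Fin n →₀ ℕ} :
    c ∈ exponentSet (cyclePathIdeal K n m ^ t) ↔
      ∃ y : Fin n → ℕ, ∑ i, y i = t ∧ ∀ v, t ≤ c v + ∑ i with v ∈ cyclicArc i (n - m), y i := by
  rw [cyclePathIdeal_eq_span_prod_compl hm, mem_exponentSet_span_prod_compl_X_pow_iff]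

theorem mem_cyclicArc_one {i v : Fin n} : v ∈ cyclicArc i 1 ↔ i = v := by
  have : NeZero n := ⟨i.pos.ne'⟩
  rw [mem_cyclicArc, Nat.lt_one_iff, Fin.val_eq_zero_iff, sub_eq_zero, eq_comm]

theorem mem_cyclicArc_two [NeZero n] {i v : Fin n} : v ∈ cyclicArc i 2 ↔ i = v ∨ i = v - 1 := by
  have hval : ∀ u : Fin n, u.val < 2 ↔ u = 0 ∨ u = 1 := by
    intro u
    rcases (Nat.one_le_iff_ne_zero.2 (NeZero.ne n)).eq_or_lt with rfl | hn
    · simp [Subsingleton.elim u 0]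
    · rw [Fin.ext_iff, Fin.ext_iff, Fin.val_zero, Fin.val_one', Nat.mod_eq_of_lt hn]
      omega
  rw [mem_cyclicArc, hval, sub_eq_zero, sub_eq_iff_eq_add', eq_sub_iff_add_eq, eq_comm,
    eq_comm (a := v)]

theorem sum_filter_mem_cyclicArc_two [NeZero n] (hn : 2 ≤ n) (y : Fin n → ℕ) (v : Fin n) :
    ∑ i with v ∈ cyclicArc i 2, y i = y v + y (v - 1) := by
  have hv : v ≠ v - 1 := by
    rw [Ne, eq_comm, sub_eq_self, Fin.ext_iff, Fin.val_one', Nat.mod_eq_of_lt hn]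
    exact one_ne_zero
  rw [← Finset.sum_pair hv]
  congr 1
  ext i
  simp [mem_cyclicArc_two]

theorem mem_exponentSet_cyclePathIdeal_sub_two_pow_iff [NeZero n] (hn : 2 ≤ n) {t : ℕ}
    {c : Fin n →₀ ℕ} :
    c ∈ exponentSet (cyclePathIdeal K n (n - 2) ^ t) ↔
      ∃ y : Fin n → ℕ, ∑ v, y v = t ∧ ∀ v, t - c v ≤ y v + y (v - 1) := by
  simp only [mem_exponentSet_cyclePathIdeal_pow_iff (Nat.sub_le n 2), Nat.sub_sub_self hn,
    sum_filter_mem_cyclicArc_two hn, tsub_le_iff_left]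

theorem mem_exponentSet_cyclePathIdeal_sub_one_pow_iff [NeZero n] {t : ℕ} {c : Fin n →₀ ℕ} :
    c ∈ exponentSet (cyclePathIdeal K n (n - 1) ^ t) ↔ ∑ v, (t - c v) ≤ t := by
  have hn : n - (n - 1) = 1 := Nat.sub_sub_self NeZero.one_le
  simp only [mem_exponentSet_cyclePathIdeal_pow_iff (Nat.sub_le n 1), hn, mem_cyclicArc_one,
    Finset.filter_eq', Finset.mem_univ, if_true, Finset.sum_singleton, ← tsub_le_iff_left]
  constructor
  · rintro ⟨y, hy, hle⟩
    exact (Finset.sum_le_sum fun v _ => hle v).trans hy.le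
  · intro h
    refine ⟨(fun v => t - c v) + Pi.single 0 (t - ∑ v, (t - c v)), ?_, fun v => le_self_add⟩
    simp [Finset.sum_add_distrib, h]

end CyclePathIdeal

section EdgeCover

/-- A form of Kőnig's theorem: `Fin t` indexes edges of `ρ` and single points that together
cover `α ⊕ β`. -/
theorem exists_injective_fin_of_card_add_card_le {α β : Type*} [Finite α] [Finite β]
    {ρ : α → β → Prop} {t : ℕ}
    (h : ∀ (S : Finset α) (T : Finset β), (∀ x ∈ S, ∀ z ∈ T, ¬ ρ x z) → S.card + T.card ≤ t) :
    ∃ (f : α → Fin t) (g : β → Fin t), f.Injective ∧ g.Injective ∧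
      ∀ x z, f x = g z → ρ x z := by
  classical
  have := Fintype.ofFinite α
  have := Fintype.ofFinite β
  have hβ : Fintype.card β ≤ t := by simpa using h ∅ Finset.univ
  let N : α → Finset (β ⊕ Fin (t - Fintype.card β)) := fun x =>
    ({z | ρ x z} : Finset β).disjSum Finset.univ
  have hall : ∀ S : Finset α, S.card ≤ (S.biUnion N).card := by
    intro S
    rcases S.eq_empty_or_nonempty with rfl | ⟨x₀, hx₀⟩
    · simp
    let T : Finset β := {z | ∃ x ∈ S, ρ x z}
    have hle : S.card + Tᶜ.card ≤ t := h S Tᶜ (by simp +contextual [T])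
    have hsub : T.disjSum Finset.univ ⊆ S.biUnion N := by
      rintro (z | j) hz
      · simpa [N, T] using hz
      · simpa [N] using ⟨x₀, hx₀⟩
    have hcard := Finset.card_le_card hsub
    rw [Finset.card_disjSum, Finset.card_fin] at hcard
    have := T.card_add_card_compl
    omega
  obtain ⟨F, hF, hFN⟩ := (Finset.all_card_le_biUnion_card_iff_exists_injective N).1 hall
  have e : β ⊕ Fin (t - Fintype.card β) ≃ Fin t :=
    Fintype.equivFinOfCardEq (by simp [Nat.add_sub_cancel' hβ])
  refine ⟨e ∘ F, e ∘ Sum.inl, e.injective.comp hF, e.injective.comp Sum.inl_injective,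
    fun x z hxz => ?_⟩
  have := hFN x
  rw [e.injective hxz] at this
  simpa [N] using this

theorem card_le_sum_fin_fst_image {α : Type*} [DecidableEq α] {d : α → ℕ}
    (S : Finset (Σ x, Fin (d x))) : S.card ≤ ∑ x ∈ S.image Sigma.fst, d x := by
  have hsub : S ⊆ (S.image Sigma.fst).sigma fun x => (Finset.univ : Finset (Fin (d x))) :=
    fun p hp => Finset.mem_sigma.2 ⟨Finset.mem_image_of_mem _ hp, Finset.mem_univ _⟩
  simpa [Finset.card_sigma] using Finset.card_le_card hsub

theorem le_sum_card_fiber {α E : Type*} [Fintype E] [DecidableEq E] {d : α → ℕ} {t : ℕ}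
    {f : (Σ x, Fin (d x)) → Fin t} (hf : f.Injective) (ε : Fin t → E) {a : α → E → Prop}
    [∀ x, DecidablePred (a x)] (hε : ∀ p, a p.1 (ε (f p))) (x : α) :
    d x ≤ ∑ e with a x e, #{k | ε k = e} := by
  calc d x = (Finset.univ.image (f ∘ Sigma.mk x)).card := by
        rw [Finset.card_image_of_injective _ (hf.comp sigma_mk_injective), Finset.card_fin]
    _ ≤ #{k | a x (ε k)} := by
        refine Finset.card_le_card fun k hk => ?_
        obtain ⟨j, -, rfl⟩ := Finset.mem_image.1 hk
        exact Finset.mem_filter.2 ⟨Finset.mem_univ _, hε ⟨x, j⟩⟩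
    _ = ∑ e with a x e, #{k | ε k = e} := by
        simpa using (Finset.sum_card_fiberwise_eq_card_filter Finset.univ
          (Finset.univ.filter (a x)) ε).symm

/-- Egerváry's theorem for weighted edge covers of a bipartite graph with edges `E` and vertex
classes `α`, `β`, where `a x e` and `b z e` express incidence and `d`, `d'` are the demands. -/
theorem exists_weighted_edge_cover {α β E : Type*} [Finite α] [Finite β] [Fintype E] [Nonempty E]
    {a : α → E → Prop} {b : β → E → Prop} [∀ x, DecidablePred (a x)] [∀ z, DecidablePred (b z)]
    {d : α → ℕ} {d' : β → ℕ} {t : ℕ} (ha : ∀ x, ∃ e, a x e) (hb : ∀ z, ∃ e, b z e)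
    (h : ∀ (S : Finset α) (T : Finset β), (∀ x ∈ S, ∀ z ∈ T, ∀ e, a x e → ¬ b z e) →
      ∑ x ∈ S, d x + ∑ z ∈ T, d' z ≤ t) :
    ∃ y : E → ℕ, ∑ e, y e = t ∧ (∀ x, d x ≤ ∑ e with a x e, y e) ∧
      ∀ z, d' z ≤ ∑ e with b z e, y e := by
  classical
  obtain ⟨f, g, hf, hg, hfg⟩ := exists_injective_fin_of_card_add_card_le (t := t)
    (ρ := fun (p : Σ x, Fin (d x)) (q : Σ z, Fin (d' z)) => ∃ e, a p.1 e ∧ b q.1 e) fun S T hST =>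
      (add_le_add (card_le_sum_fin_fst_image S) (card_le_sum_fin_fst_image T)).trans
        (h _ _ fun x hx z hz e hae hbe => by
          obtain ⟨p, hp, rfl⟩ := Finset.mem_image.1 hx
          obtain ⟨q, hq, rfl⟩ := Finset.mem_image.1 hz
          exact hST p hp q hq ⟨e, hae, hbe⟩)
  have hε : ∀ k : Fin t, ∃ e, (∀ p, f p = k → a p.1 e) ∧ ∀ q, g q = k → b q.1 e := by
    intro k
    by_cases hp : ∃ p, f p = k <;> by_cases hq : ∃ q, g q = k
    · obtain ⟨p, rfl⟩ := hp
      obtain ⟨q, hq⟩ := hq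
      obtain ⟨e, hae, hbe⟩ := hfg p q hq.symm
      exact ⟨e, fun p' hp' => hf hp' ▸ hae, fun q' hq' => hg (hq'.trans hq.symm) ▸ hbe⟩
    · obtain ⟨p, rfl⟩ := hp
      obtain ⟨e, hae⟩ := ha p.1
      exact ⟨e, fun p' hp' => hf hp' ▸ hae, fun q hq' => absurd ⟨q, hq'⟩ hq⟩
    · obtain ⟨q, rfl⟩ := hq
      obtain ⟨e, hbe⟩ := hb q.1
      exact ⟨e, fun p hp' => absurd ⟨p, hp'⟩ hp, fun q' hq' => hg hq' ▸ hbe⟩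
    · exact ⟨Classical.arbitrary E, fun p hp' => absurd ⟨p, hp'⟩ hp,
        fun q hq' => absurd ⟨q, hq'⟩ hq⟩
  choose ε hεa hεb using hε
  refine ⟨fun e => #{k | ε k = e}, ?_,
    le_sum_card_fiber hf ε fun p => hεa _ p rfl, le_sum_card_fiber hg ε fun q => hεb _ q rfl⟩
  simpa using Finset.sum_card_fiberwise_eq_card_filter Finset.univ Finset.univ ε

end EdgeCover

section Cycle

variable {n : ℕ} [NeZero n]

/-- A set of vertices of the `n`-cycle with vertices `Fin n` and edges `{v, v + 1}` which contains
no edge. -/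
def IsCycleIndependent (T : Finset (Fin n)) : Prop :=
  ∀ v ∈ T, v + 1 ∉ T

/-- A colour class of a proper 2-colouring of the `n`-cycle. -/
def IsCycleColorClass (T : Finset (Fin n)) : Prop :=
  ∀ v, v + 1 ∈ T ↔ v ∉ T

theorem IsCycleColorClass.isCycleIndependent {T : Finset (Fin n)} (hT : IsCycleColorClass T) :
    IsCycleIndependent T :=
  fun v hv hv' => (hT v).1 hv' hv

theorem IsCycleIndependent.sum_add_sub_one_le {T : Finset (Fin n)} (hT : IsCycleIndependent T)
    (y : Fin n → ℕ) : ∑ v ∈ T, (y v + y (v - 1)) ≤ ∑ v, y v := by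
  have hshift : ∑ v ∈ T, y (v - 1) = ∑ v ∈ T.image (· - 1), y v :=
    (Finset.sum_image fun a _ b _ hab => sub_left_injective hab).symm
  have hdisj : Disjoint T (T.image (· - 1)) := by
    rw [Finset.disjoint_right]
    intro v hv hvT
    obtain ⟨w, hw, rfl⟩ := Finset.mem_image.1 hv
    exact hT _ hvT (by rwa [sub_add_cancel])
  rw [Finset.sum_add_distrib, hshift, ← Finset.sum_union hdisj]
  exact Finset.sum_le_sum_of_subset (Finset.subset_univ _)

theorem IsCycleColorClass.sum_add_sub_one_eq {T : Finset (Fin n)} (hT : IsCycleColorClass T)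
    (y : Fin n → ℕ) : ∑ v ∈ T, (y v + y (v - 1)) = ∑ v, y v := by
  have hshift : ∑ v ∈ T, y (v - 1) = ∑ v ∈ Tᶜ, y v :=
    Finset.sum_equiv (Equiv.subRight 1) (fun v => by simp [← hT (v - 1)]) fun _ _ => rfl
  rw [Finset.sum_add_distrib, hshift, Finset.sum_add_sum_compl]

theorem IsCycleColorClass.two_mul_card {T : Finset (Fin n)} (hT : IsCycleColorClass T) :
    2 * #T = n := by
  simpa [mul_comm] using hT.sum_add_sub_one_eq 1

theorem IsCycleIndependent.isCycleColorClass {T : Finset (Fin n)} (hT : IsCycleIndependent T)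
    (hcard : n ≤ 2 * #T) : IsCycleColorClass T := by
  have hsub : T.image (· + 1) ⊆ Tᶜ := fun v hv => by
    obtain ⟨w, hw, rfl⟩ := Finset.mem_image.1 hv
    exact Finset.mem_compl.2 (hT w hw)
  have heq : T.image (· + 1) = Tᶜ := by
    refine Finset.eq_of_subset_of_card_le hsub ?_
    rw [Finset.card_compl, Fintype.card_fin,
      Finset.card_image_of_injective _ (add_left_injective 1)]
    omega
  intro v
  rw [← not_iff_not, ← Finset.mem_compl, ← heq, not_not, Finset.mem_image]
  simp

theorem IsCycleColorClass.mem_iff {T : Finset (Fin n)} (hT : IsCycleColorClass T) (v : Fin n) :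
    v ∈ T ↔ (Even v.val ↔ 0 ∈ T) := by
  obtain ⟨k, hk⟩ := v
  induction k with
  | zero => simp
  | succ k ih =>
    have hsucc : (⟨k + 1, hk⟩ : Fin n) = ⟨k, by omega⟩ + 1 := by
      rw [Fin.ext_iff, Fin.val_add, Fin.val_one', Nat.add_mod_mod, Nat.mod_eq_of_lt hk]
    rw [hsucc, hT, ih, ← hsucc, Nat.even_add_one]
    tauto

theorem IsCycleIndependent.two_mul_card_lt {T : Finset (Fin n)} (hT : IsCycleIndependent T)
    {i j : Fin n} (hi : Even i.val) (hj : ¬ Even j.val) (hiT : i ∉ T) (hjT : j ∉ T) :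
    2 * #T < n := by
  by_contra! hcard
  have hT' := hT.isCycleColorClass hcard
  rw [hT'.mem_iff] at hiT hjT
  tauto

theorem even_val_add_one_iff (hn : Even n) (v : Fin n) : Even (v + 1).val ↔ ¬ Even v.val := by
  rw [Fin.val_add, Fin.val_one', Nat.add_mod_mod, hn.mod_even_iff, Nat.even_add_one]

theorem isCycleColorClass_even (hn : Even n) :
    IsCycleColorClass ({v | Even v.val} : Finset (Fin n)) := fun v => by
  simp [even_val_add_one_iff hn]

theorem isCycleColorClass_not_even (hn : Even n) :
    IsCycleColorClass ({v | ¬ Even v.val} : Finset (Fin n)) := fun v => by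
  simp only [Finset.mem_filter, Finset.mem_univ, true_and, even_val_add_one_iff hn]

theorem isCycleIndependent_union (hn : Even n) {S T : Finset (Fin n)} (hS : ∀ v ∈ S, Even v.val)
    (hT : ∀ v ∈ T, ¬ Even v.val) (hST : ∀ v ∈ S, v + 1 ∉ T) (hTS : ∀ v ∈ T, v + 1 ∉ S) :
    IsCycleIndependent (S ∪ T) := by
  intro v hv hv'
  have hpar := even_val_add_one_iff hn v
  rcases Finset.mem_union.1 hv with hv | hv <;> rcases Finset.mem_union.1 hv' with hv' | hv'
  · exact hpar.1 (hS _ hv') (hS _ hv)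
  · exact hST v hv hv'
  · exact hTS v hv hv'
  · exact hT _ hv' (hpar.2 (hT _ hv))

theorem exists_cycle_edge_cover (hn : Even n) {d : Fin n → ℕ} {t : ℕ}
    (h : ∀ T : Finset (Fin n), IsCycleIndependent T → ∑ v ∈ T, d v ≤ t) :
    ∃ y : Fin n → ℕ, ∑ v, y v = t ∧ ∀ v, d v ≤ y v + y (v - 1) := by
  have hn2 : 2 ≤ n := Nat.le_of_dvd (NeZero.pos n) hn.two_dvd
  have hedge : ∀ v : Fin n, v ∈ cyclicArc v 2 := fun v => mem_cyclicArc_two.2 (Or.inl rfl)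
  have hedge' : ∀ v : Fin n, v + 1 ∈ cyclicArc v 2 := fun v => mem_cyclicArc_two.2 (by simp)
  obtain ⟨y, hy, hyE, hyO⟩ := exists_weighted_edge_cover (t := t)
    (a := fun (x : {v : Fin n // Even v.val}) e => x.1 ∈ cyclicArc e 2)
    (b := fun (z : {v : Fin n // ¬ Even v.val}) e => z.1 ∈ cyclicArc e 2)
    (d := fun x => d x.1) (d' := fun z => d z.1) (fun x => ⟨_, hedge _⟩) (fun z => ⟨_, hedge _⟩)
    fun S T hST => by
      have hdisj : Disjoint (S.map (.subtype _)) (T.map (.subtype _)) := by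
        simp +contextual [Finset.disjoint_left]
      have hindep : IsCycleIndependent (S.map (.subtype _) ∪ T.map (.subtype _)) := by
        refine isCycleIndependent_union hn (by simp +contextual) (by simp +contextual) ?_ ?_
        · simp only [Finset.mem_map, Function.Embedding.subtype_apply, not_exists, not_and]
          rintro _ ⟨x, hx, rfl⟩ z hz hzx
          exact hST x hx z hz x.1 (hedge _) (hzx ▸ hedge' x.1)
        · simp only [Finset.mem_map, Function.Embedding.subtype_apply, not_exists, not_and]
          rintro _ ⟨z, hz, rfl⟩ x hx hxz
          exact hST x hx z hz z.1 (hxz ▸ hedge' z.1) (hedge _)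
      simpa only [Finset.sum_union hdisj, Finset.sum_map, Function.Embedding.subtype_apply]
        using h _ hindep
  simp only [sum_filter_mem_cyclicArc_two hn2] at hyE hyO
  exact ⟨y, hy, fun v => (em (Even v.val)).elim (fun hv => hyE ⟨v, hv⟩) fun hv => hyO ⟨v, hv⟩⟩

theorem exists_matching_of_odd (hn : Odd n) (i : Fin n) :
    ∃ y : Fin n → ℕ, ∀ v, y v + y (v - 1) + (if v = i then 1 else 0) = 1 := by
  cases n with
  | zero => exact i.elim0
  | succ m =>
    have hm : m % 2 = 0 := Nat.even_iff.1 (by simpa [Nat.odd_add_one] using hn)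
    refine ⟨fun v => if (v - i).val % 2 = 1 then 1 else 0, fun v => ?_⟩
    dsimp only
    rw [sub_right_comm, Fin.coe_sub_one]
    have hval : v = i ↔ (v - i).val = 0 := by rw [Fin.val_eq_zero_iff, sub_eq_zero]
    simp only [hval, sub_eq_zero]
    split_ifs <;> omega

end Cycle

section CyclePathIdealPower

theorem exists_exponent_add_eq {n t : ℕ} {D : Fin n → ℕ} (hD : ∀ v, D v ≤ t) :
    ∃ c : Fin n →₀ ℕ, ∀ v, c v + D v = t :=
  ⟨Finsupp.equivFunOnFinite.symm fun v => t - D v, fun v => by simp [hD v]⟩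

variable {K : Type*} [Field K] {n t : ℕ} [NeZero n] {c : Fin n →₀ ℕ}

theorem isSocleExponent_cyclePathIdeal_sub_one_pow (hc : ∀ v, c v < t)
    (hsum : ∑ v, (t - c v) = t + 1) :
    IsSocleExponent (exponentSet (cyclePathIdeal K n (n - 1) ^ t)) c := by
  simp only [IsSocleExponent, mem_exponentSet_cyclePathIdeal_sub_one_pow_iff]
  refine ⟨by omega, fun i => Nat.le_of_lt_succ ?_⟩
  rw [Nat.succ_eq_add_one, ← hsum]
  refine Finset.sum_lt_sum (fun v _ => Nat.sub_le_sub_left ?_ t) ⟨i, Finset.mem_univ i, ?_⟩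
  · exact le_self_add
  · have := hc i
    rw [Finsupp.add_apply, Finsupp.single_eq_same]
    omega

theorem exists_isSocleExponent_cyclePathIdeal_sub_one_pow (hn : 2 ≤ n) (ht : n - 1 ≤ t) :
    ∃ c, IsSocleExponent (exponentSet (cyclePathIdeal K n (n - 1) ^ t)) c := by
  obtain ⟨s, rfl⟩ := Nat.exists_eq_add_of_le ht
  let D : Fin n → ℕ := 1 + Pi.single 0 s
  have hD : ∀ v, 1 ≤ D v ∧ D v ≤ n - 1 + s := fun v => by
    simp only [D, Pi.add_apply, Pi.one_apply, Pi.single_apply]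
    split_ifs <;> omega
  obtain ⟨c, hc⟩ := exists_exponent_add_eq fun v => (hD v).2
  have hcD : ∀ v, n - 1 + s - c v = D v := fun v => by have := hc v; omega
  refine ⟨c, isSocleExponent_cyclePathIdeal_sub_one_pow (fun v => ?_) ?_⟩
  · have := hc v
    have := (hD v).1
    omega
  · simp only [hcD, D, Pi.add_apply, Pi.one_apply, Finset.sum_add_distrib, Finset.sum_pi_single',
      Finset.sum_const, Finset.card_fin, smul_eq_mul, mul_one, Finset.mem_univ, if_true]
    omega

theorem mem_exponentSet_cyclePathIdeal_sub_two_pow_iff_of_even (hn : Even n) :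
    c ∈ exponentSet (cyclePathIdeal K n (n - 2) ^ t) ↔
      ∀ T, IsCycleIndependent T → ∑ v ∈ T, (t - c v) ≤ t := by
  rw [mem_exponentSet_cyclePathIdeal_sub_two_pow_iff (Nat.le_of_dvd (NeZero.pos n) hn.two_dvd)]
  constructor
  · rintro ⟨y, rfl, hy⟩ T hT
    exact (Finset.sum_le_sum fun v _ => hy v).trans (hT.sum_add_sub_one_le y)
  · exact exists_cycle_edge_cover hn

theorem not_isSocleExponent_cyclePathIdeal_sub_two_pow (hn : Even n) (c : Fin n →₀ ℕ) :
    ¬ IsSocleExponent (exponentSet (cyclePathIdeal K n (n - 2) ^ t)) c := by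
  rintro ⟨hc, hsocle⟩
  simp only [mem_exponentSet_cyclePathIdeal_sub_two_pow_iff_of_even hn] at hc hsocle
  push Not at hc
  obtain ⟨T, hT, hlt⟩ := hc
  obtain ⟨v, hv⟩ : T.Nonempty := Finset.nonempty_of_sum_ne_zero (Nat.ne_zero_of_lt hlt)
  refine hlt.not_ge (le_of_eq_of_le (Finset.sum_congr rfl fun w hw => ?_) (hsocle (v + 1) T hT))
  rw [Finsupp.add_apply, Finsupp.single_eq_of_ne (ne_of_mem_of_not_mem hw (hT v hv)), add_zero]

theorem exists_exponent_add_edge_weights {y : Fin n → ℕ} (hn : 2 ≤ n) (ht : ∑ v, y v < t) :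
    ∃ c : Fin n →₀ ℕ, ∀ v, c v + (y v + y (v - 1) + 1) = t :=
  exists_exponent_add_eq fun v => by
    rw [← sum_filter_mem_cyclicArc_two hn y v]
    exact (Finset.sum_le_univ_sum_of_nonneg fun _ => Nat.zero_le _).trans_lt ht

theorem sum_add_sub_one (y : Fin n → ℕ) : ∑ v, (y v + y (v - 1)) = 2 * ∑ v, y v := by
  have hshift : ∑ v, y (v - 1) = ∑ v, y v := Equiv.sum_comp (Equiv.subRight 1) y
  rw [Finset.sum_add_distrib, hshift, two_mul]

section EdgeWeights

variable {y : Fin n → ℕ} (hc : ∀ v, c v + (y v + y (v - 1) + 1) = t)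
include hc

theorem sub_exponent_eq_add_edge_weights (v : Fin n) : t - c v = y v + y (v - 1) + 1 := by
  have := hc v
  omega

theorem isSocleExponent_cyclePathIdeal_sub_two_pow (hn : 2 ≤ n) (hodd : Odd n)
    (ht : ∑ v, y v + n / 2 = t) :
    IsSocleExponent (exponentSet (cyclePathIdeal K n (n - 2) ^ t)) c := by
  have hn' := Nat.two_mul_div_two_add_one_of_odd hodd
  simp only [IsSocleExponent, mem_exponentSet_cyclePathIdeal_sub_two_pow_iff hn,
    sub_exponent_eq_add_edge_weights hc]
  constructor
  · rintro ⟨x, hx, hle⟩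
    have hsum := Finset.sum_le_sum fun v (_ : v ∈ Finset.univ) => hle v
    rw [sum_add_sub_one, Finset.sum_add_distrib, sum_add_sub_one] at hsum
    simp only [Finset.sum_const, Finset.card_fin, smul_eq_mul, mul_one] at hsum
    omega
  · intro i
    obtain ⟨z, hz⟩ := exists_matching_of_odd hodd i
    have hzsum : 2 * ∑ v, z v + 1 = n := by
      have hsum := Finset.sum_congr rfl fun v (_ : v ∈ Finset.univ) => hz v
      rw [Finset.sum_add_distrib, sum_add_sub_one] at hsum
      simpa using hsum
    refine ⟨y + z, ?_, fun v => ?_⟩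
    · simp only [Pi.add_apply, Finset.sum_add_distrib]
      omega
    · have := hz v
      have := hc v
      simp only [Pi.add_apply, Finsupp.add_apply, Finsupp.single_apply, eq_comm (a := i)]
      omega

theorem add_notMem_exponentSet_of_isCycleColorClass (hn : Even n) (ht : ∑ v, y v + n / 2 = t + 1)
    {T : Finset (Fin n)} (hT : IsCycleColorClass T) {e : Fin n →₀ ℕ} (he : Disjoint e.support T) :
    c + e ∉ exponentSet (cyclePathIdeal K n (n - 2) ^ t) := by
  rw [mem_exponentSet_cyclePathIdeal_sub_two_pow_iff_of_even hn]
  intro h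
  have hsum : ∑ v ∈ T, (t - (c + e) v) = ∑ v ∈ T, (y v + y (v - 1) + 1) := by
    refine Finset.sum_congr rfl fun v hv => ?_
    rw [Finsupp.add_apply, Finsupp.notMem_support_iff.1 (Finset.disjoint_right.1 he hv), add_zero,
      sub_exponent_eq_add_edge_weights hc]
  have hle := hsum.symm.trans_le (h T hT.isCycleIndependent)
  rw [Finset.sum_add_distrib, hT.sum_add_sub_one_eq, ← Finset.card_eq_sum_ones] at hle
  have := hT.two_mul_card
  omega

theorem add_single_add_single_mem_exponentSet (hn : Even n) (ht : ∑ v, y v + n / 2 = t + 1)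
    {i j : Fin n} (hi : Even i.val) (hj : ¬ Even j.val) :
    c + Finsupp.single i 1 + Finsupp.single j 1 ∈
      exponentSet (cyclePathIdeal K n (n - 2) ^ t) := by
  rw [mem_exponentSet_cyclePathIdeal_sub_two_pow_iff_of_even hn]
  intro T hT
  let T' : Finset (Fin n) := {v ∈ T | ¬ (v = i ∨ v = j)}
  have hT' : IsCycleIndependent T' := fun v hv hv' =>
    hT v (Finset.mem_filter.1 hv).1 (Finset.mem_filter.1 hv').1
  have hcard : 2 * #T' < n := hT'.two_mul_card_lt hi hj (by simp [T']) (by simp [T'])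
  calc ∑ v ∈ T, (t - (c + Finsupp.single i 1 + Finsupp.single j 1 : Fin n →₀ ℕ) v)
      ≤ ∑ v ∈ T, (y v + y (v - 1) + if ¬ (v = i ∨ v = j) then 1 else 0) := by
        refine Finset.sum_le_sum fun v _ => ?_
        have := hc v
        simp only [Finsupp.add_apply, Finsupp.single_apply, eq_comm (b := v)]
        split_ifs <;> omega
    _ = ∑ v ∈ T, (y v + y (v - 1)) + #T' := by rw [Finset.sum_add_distrib, Finset.card_filter]
    _ ≤ ∑ v, y v + #T' := by gcongr; exact hT.sum_add_sub_one_le y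
    _ ≤ t := by
        have := hn.two_dvd
        omega

end EdgeWeights

theorem exists_isSocleExponent_cyclePathIdeal_sub_two_pow (hn : 3 ≤ n) (hodd : Odd n)
    (ht : (n - 1) / 2 ≤ t) :
    ∃ c, IsSocleExponent (exponentSet (cyclePathIdeal K n (n - 2) ^ t)) c := by
  have hn' := Nat.two_mul_div_two_add_one_of_odd hodd
  have hsum : ∑ v : Fin n, Pi.single (M := fun _ => ℕ) 0 (t - n / 2) v = t - n / 2 := by simp
  obtain ⟨c, hc⟩ := exists_exponent_add_edge_weights (t := t) (by omega)
    (hsum.trans_lt (by omega))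
  exact ⟨c, isSocleExponent_cyclePathIdeal_sub_two_pow hc (by omega) hodd (by omega)⟩

theorem exists_disconnecting_exponent (hn : 3 ≤ n) (heven : Even n) (ht : n / 2 ≤ t + 1) :
    ∃ c : Fin n →₀ ℕ,
      (∀ e : Fin n →₀ ℕ, ((∀ v ∈ e.support, Even v.val) ∨ ∀ v ∈ e.support, ¬ Even v.val) →
        c + e ∉ exponentSet (cyclePathIdeal K n (n - 2) ^ t)) ∧
      ∀ i j : Fin n, Even i.val → ¬ Even j.val →
        c + Finsupp.single i 1 + Finsupp.single j 1 ∈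
          exponentSet (cyclePathIdeal K n (n - 2) ^ t) := by
  have hn' := heven.two_dvd
  have hsum : ∑ v : Fin n, Pi.single (M := fun _ => ℕ) 0 (t + 1 - n / 2) v = t + 1 - n / 2 := by
    simp
  obtain ⟨c, hc⟩ := exists_exponent_add_edge_weights (t := t) (by omega)
    (hsum.trans_lt (by omega))
  refine ⟨c, ?_, fun i j => add_single_add_single_mem_exponentSet hc heven (by omega)⟩
  rintro e (he | he)
  · refine add_notMem_exponentSet_of_isCycleColorClass hc heven (by omega)
      (isCycleColorClass_not_even heven) (Finset.disjoint_left.2 fun v hv => ?_)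
    simpa using he v hv
  · refine add_notMem_exponentSet_of_isCycleColorClass hc heven (by omega)
      (isCycleColorClass_even heven) (Finset.disjoint_left.2 fun v hv => ?_)
    simpa using he v hv

theorem stanleyDepth_cyclePathIdeal_sub_two_pow_le (hn : 3 ≤ n) (heven : Even n)
    (ht : n / 2 ≤ t + 1) :
    stanleyDepth (cyclePathIdeal K n (n - 2) ^ t) ≤ ((n / 2 : ℕ) : ℕ∞) := by
  obtain ⟨c, hout, hin⟩ := exists_disconnecting_exponent (K := K) hn heven ht
  refine stanleyDepth_le (isMonomialIdeal_cyclePathIdeal_pow (Nat.sub_le n 2) t) (c := c)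
    (by simpa using hout 0) fun Z hZ => ?_
  have hcard : ∀ {T : Finset (Fin n)}, IsCycleColorClass T → Z ⊆ T → #Z ≤ n / 2 := fun hT hZT => by
    have := hT.two_mul_card
    have := Finset.card_le_card hZT
    omega
  by_cases hZe : ∀ v ∈ Z, Even v.val
  · exact hcard (isCycleColorClass_even heven) fun v hv => by simpa using hZe v hv
  · push Not at hZe
    obtain ⟨j, hj, hjo⟩ := hZe
    refine hcard (isCycleColorClass_not_even heven) fun i hi => ?_
    rw [Finset.mem_filter]
    refine ⟨Finset.mem_univ i, fun hie => ?_⟩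
    refine hZ (Finsupp.single i 1 + Finsupp.single j 1) ?_ ?_
    · exact Finsupp.support_add.trans (Finset.union_subset
        (Finsupp.support_single_subset.trans (Finset.singleton_subset_iff.2 hi))
        (Finsupp.support_single_subset.trans (Finset.singleton_subset_iff.2 hj)))
    · exact add_assoc c _ _ ▸ hin i j hie (by simpa using hjo)

theorem one_le_stanleyDepth_cyclePathIdeal_sub_two_pow (heven : Even n) :
    1 ≤ stanleyDepth (cyclePathIdeal K n (n - 2) ^ t) :=
  one_le_stanleyDepth (isMonomialIdeal_cyclePathIdeal_pow (Nat.sub_le n 2) t)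
    (not_isSocleExponent_cyclePathIdeal_sub_two_pow heven)

theorem polyDepth_cyclePathIdeal_sub_two_pow_eq_one (hn : 3 ≤ n) (heven : Even n)
    (ht : n / 2 ≤ t + 1) :
    polyDepth K n (MvPolynomial (Fin n) K ⧸ cyclePathIdeal K n (n - 2) ^ t) = 1 := by
  have hI := isMonomialIdeal_cyclePathIdeal_pow (K := K) (Nat.sub_le n 2) t
  obtain ⟨c, hout, hin⟩ := exists_disconnecting_exponent (K := K) hn heven ht
  have h0 : Even (0 : Fin n).val := by simp
  have h1 : ¬ Even (0 + 1 : Fin n).val := fun h => (even_val_add_one_iff heven 0).1 h h0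
  have hsupp : ∀ (i v : Fin n), v ∈ (Finsupp.single i 1).support → v = i := fun i v hv =>
    Finset.mem_singleton.1 (Finsupp.support_single_subset hv)
  refine le_antisymm (polyDepth_le_one hI {v | Even v.val} h0 h1
    (hout _ (Or.inl fun v hv => hsupp _ v hv ▸ h0)) (hout _ (Or.inr fun v hv => hsupp _ v hv ▸ h1))
    fun i hi j hj => hin i j hi hj) (one_le_polyDepth hI (fun htop => ?_)
      (not_isSocleExponent_cyclePathIdeal_sub_two_pow heven))
  exact hout 0 (by simp) (by simp [exponentSet, htop])

end CyclePathIdealPower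

theorem theorem2p2_general (K : Type*) [Field K] (n t : ℕ) :
    (2 ≤ n → n - 1 ≤ t →
      stanleyDepth (cyclePathIdeal K n (n - 1) ^ t) = 0 ∧
      polyDepth K n (MvPolynomial (Fin n) K ⧸ cyclePathIdeal K n (n - 1) ^ t) = 0) ∧
    (3 ≤ n → Odd n → (n - 1) / 2 ≤ t →
      stanleyDepth (cyclePathIdeal K n (n - 2) ^ t) = 0 ∧
      polyDepth K n (MvPolynomial (Fin n) K ⧸ cyclePathIdeal K n (n - 2) ^ t) = 0) ∧
    (3 ≤ n → Even n → n / 2 ≤ t + 1 →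
      stanleyDepth (cyclePathIdeal K n (n - 2) ^ t) ≤ ((n / 2 : ℕ) : ℕ∞) ∧
      polyDepth K n (MvPolynomial (Fin n) K ⧸ cyclePathIdeal K n (n - 2) ^ t) ≤
        stanleyDepth (cyclePathIdeal K n (n - 2) ^ t) ∧
      polyDepth K n (MvPolynomial (Fin n) K ⧸ cyclePathIdeal K n (n - 2) ^ t) = 1) := by
  refine ⟨fun hn ht => ?_, fun hn hodd ht => ?_, fun hn heven ht => ?_⟩ <;>
    have : NeZero n := ⟨by omega⟩
  · obtain ⟨c, hc⟩ := exists_isSocleExponent_cyclePathIdeal_sub_one_pow (K := K) hn ht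
    exact ⟨stanleyDepth_eq_zero (isMonomialIdeal_cyclePathIdeal_pow (Nat.sub_le n 1) t) hc,
      polyDepth_eq_zero hc⟩
  · obtain ⟨c, hc⟩ := exists_isSocleExponent_cyclePathIdeal_sub_two_pow (K := K) hn hodd ht
    exact ⟨stanleyDepth_eq_zero (isMonomialIdeal_cyclePathIdeal_pow (Nat.sub_le n 2) t) hc,
      polyDepth_eq_zero hc⟩
  · have hdepth := polyDepth_cyclePathIdeal_sub_two_pow_eq_one (K := K) hn heven ht
    exact ⟨stanleyDepth_cyclePathIdeal_sub_two_pow_le hn heven ht,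
      hdepth.trans_le (one_le_stanleyDepth_cyclePathIdeal_sub_two_pow heven), hdepth⟩

theorem theorem2p2 (K : Type*) [Field K] (n t : ℕ) :
    (2 ≤ n → n - 1 ≤ t →
      stanleyDepth (cyclePathIdeal K n (n - 1) ^ t) = 0 ∧
      polyDepth K n (MvPolynomial (Fin n) K ⧸ cyclePathIdeal K n (n - 1) ^ t) = 0) ∧
    (3 ≤ n → Odd n → (n - 1) / 2 ≤ t →
      stanleyDepth (cyclePathIdeal K n (n - 2) ^ t) = 0 ∧
      polyDepth K n (MvPolynomial (Fin n) K ⧸ cyclePathIdeal K n (n - 2) ^ t) = 0) ∧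
    (3 ≤ n → Even n → n - 1 ≤ t →
      stanleyDepth (cyclePathIdeal K n (n - 2) ^ t) ≤ ((n / 2 : ℕ) : ℕ∞) ∧
      polyDepth K n (MvPolynomial (Fin n) K ⧸ cyclePathIdeal K n (n - 2) ^ t) ≤
        stanleyDepth (cyclePathIdeal K n (n - 2) ^ t) ∧
      polyDepth K n (MvPolynomial (Fin n) K ⧸ cyclePathIdeal K n (n - 2) ^ t) = 1) := by
  obtain ⟨h₁, h₂, h₃⟩ := theorem2p2_general K n t
  exact ⟨h₁, h₂, fun hn heven ht => h₃ hn heven (by omega)⟩
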